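/- Let $\tau\ge 2$ be a real number, let $A\ge 1$ be an integer, and let $b=-A+i$ or $b=-A-i$. Let \[ \mathcal K_{\{0,1\}}=\Bigl\{\sum_{j=1}^{\infty} d_j b^{-j} : d_j\in\{0,1\}\text{ for all } j\ge 1\Bigr\}\subset\mathbb C . \] For $\xi\in\mathbb C\setminus\mathbb Q(i)$, the Gaussian irrationality exponent of $\xi$ is \[ \mu(\xi)=\sup\Bigl\{\nu\in\mathbb R : \Bigl|\xi-\frac pq\Bigr|<\frac1{|q|^{\nu}}\text{ for infinitely many } \frac pq\in\mathbb Q(i),\ p,q\in\mathbb Z[i],\ q\neq 0\Bigr\}\in\mathbb R\cup\{+\infty\}. \] Then $\mathcal K_{\{0,1\}}$ contains uncountably many complex numbers $\xi\in\mathbb C\setminus\mathbb Q(i)$ with $\mu(\xi)=\tau$. -/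

import Mathlib

/-- The numbers `∑_{j ≥ 1} d_j b^{-j}` with all digits `d_j` (`j ≥ 1`) in `J`.
The digit `d_{j+1}` is stored as `d j`. -/
def digitSeriesSet (b : ℂ) (J : Set ℕ) : Set ℂ :=
  {ζ | ∃ d : ℕ → ℕ, (∀ j, d j ∈ J) ∧ HasSum (fun j : ℕ => (d j : ℂ) * (b ^ (j + 1))⁻¹) ζ}

/-- The field `ℚ(i)` of Gaussian rationals, as a subset of `ℂ`. -/
def gaussianRationals : Set ℂ :=
  {r | ∃ p q : GaussianInt, q ≠ 0 ∧ r = (p : ℂ) / (q : ℂ)}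

/-- The Gaussian rationals `p / q` with `|ξ - p / q| < 1 / |q| ^ ν`. -/
def gaussianApproximants (ξ : ℂ) (ν : ℝ) : Set ℂ :=
  {r | ∃ p q : GaussianInt, q ≠ 0 ∧ r = (p : ℂ) / (q : ℂ) ∧
    ‖ξ - r‖ < 1 / ‖(q : ℂ)‖ ^ ν}

/-- The Gaussian irrationality exponent of `ξ`: the supremum, in the extended reals, of all real
`ν` such that `|ξ - p / q| < 1 / |q| ^ ν` for infinitely many Gaussian rationals `p / q`.
It is meant for `ξ` outside `ℚ(i)`. -/
noncomputable def gaussianIrrationalityExponent (ξ : ℂ) : EReal :=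
  sSup ((fun ν : ℝ => (ν : EReal)) '' {ν : ℝ | (gaussianApproximants ξ ν).Infinite})

/-! Take `ξ = ∑ b ^ (-n k)` with `n (k + 1)` within a bounded distance of `τ * n k`. A truncation
has denominator `Q = b ^ n j` and error about `|Q| ^ (-τ)`, so the exponent is at least `τ`.

For the converse, `τ ≥ 2` gives `n (j + 1) ≥ 2 * n j`, so consecutive truncations are `P / Q` and `P
/ Q + 1 / (x Q ^ 2)` with `x` a Gaussian integer. By `BadlyApproximable.fold`, such a step costs a
lower bound of order `ν > 2` only a factor `1 - δ`. The `δ` can be chosen summable, so for each `ν >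
τ` a bound survives in the limit (`exists_lower_bound_of_tendsto_fold`); it also excludes `ξ ∈
ℚ(i)`.

A free bit in each exponent disturbs none of this, and `injective_perturbedSeries` then yields
uncountably many `ξ`. -/

theorem one_le_norm_toComplex {q : GaussianInt} (hq : q ≠ 0) : 1 ≤ ‖(q : ℂ)‖ := by
  have h1 : (0 : ℤ) < q.norm := GaussianInt.norm_pos.2 hq
  have h2 : ((q.norm : ℤ) : ℝ) = ‖(q : ℂ)‖ ^ 2 := by
    rw [GaussianInt.intCast_real_norm, Complex.normSq_eq_norm_sq]
  have h3 : (1 : ℝ) ≤ ‖(q : ℂ)‖ ^ 2 := by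
    rw [← h2]; exact_mod_cast h1
  nlinarith [norm_nonneg (q : ℂ)]

/-! ### Folding and bad approximability -/

/-- `P / Q` is approximated by every other Gaussian rational `p / q` at distance at least
`c / |q| ^ ν`. -/
def BadlyApproximable (ν c : ℝ) (P Q : GaussianInt) : Prop :=
  ∀ p q : GaussianInt, q ≠ 0 → q * P - p * Q ≠ 0 →
    c * ‖(Q : ℂ)‖ ≤ ‖((q * P - p * Q : GaussianInt) : ℂ)‖ * ‖(q : ℂ)‖ ^ (ν - 1)

theorem badlyApproximable_of_mul_norm_le_one {ν : ℝ} (hν : 1 ≤ ν) {P Q : GaussianInt} {c : ℝ}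
    (hc : c * ‖(Q : ℂ)‖ ≤ 1) : BadlyApproximable ν c P Q := by
  intro p q hq hL
  have h1 := one_le_norm_toComplex hL
  have h2 : 1 ≤ ‖(q : ℂ)‖ ^ (ν - 1) :=
    Real.one_le_rpow (one_le_norm_toComplex hq) (by linarith)
  nlinarith

/-- The folding step: bad approximability passes from `P / Q` to `P / Q + 1 / (x Q ^ 2)`. -/
theorem BadlyApproximable.fold {ν c δ : ℝ} (hν : 2 < ν) (hc0 : 0 ≤ c) (hc1 : c ≤ 1)
    (hδ0 : 0 < δ) (hδ1 : δ < 1) {P Q x : GaussianInt} (hQ : Q ≠ 0) (hx : x ≠ 0)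
    (hco : IsCoprime P Q) (hδQ : 1 ≤ δ ^ (1 + ν) * ‖(Q : ℂ)‖ ^ (ν - 2))
    (hQx : ‖((x * Q ^ 2 : GaussianInt) : ℂ)‖ ≤ ‖(Q : ℂ)‖ ^ ν) (h : BadlyApproximable ν c P Q) :
    BadlyApproximable ν ((1 - δ) * c) (x * Q * P + 1) (x * Q ^ 2) := by
  intro p q hq hL
  set L' : GaussianInt := q * P - p * Q with hL'
  have hLeq : q * (x * Q * P + 1) - p * (x * Q ^ 2) = x * Q * L' + q := by rw [hL']; ring
  rw [hLeq] at hL ⊢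
  set L : GaussianInt := x * Q * L' + q with hLdef
  have nx := one_le_norm_toComplex hx
  have nQ := one_le_norm_toComplex hQ
  have nq := one_le_norm_toComplex hq
  have nL := one_le_norm_toComplex hL
  have hcδ : (1 - δ) * c ≤ 1 := by nlinarith
  have hcδ0 : 0 ≤ (1 - δ) * c := by nlinarith
  have hQ' : ‖((x * Q ^ 2 : GaussianInt) : ℂ)‖ = ‖(x : ℂ)‖ * ‖(Q : ℂ)‖ * ‖(Q : ℂ)‖ := by
    simp [pow_two, mul_assoc]
  have hqν : ‖(q : ℂ)‖ * ‖(q : ℂ)‖ ^ (ν - 1) = ‖(q : ℂ)‖ ^ ν := by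
    rw [← Real.rpow_one_add' (norm_nonneg _) (by linarith)]; congr 1; ring
  have hqpos : 0 < ‖(q : ℂ)‖ ^ (ν - 1) := Real.rpow_pos_of_pos (by linarith) _
  -- it suffices to bound by the unscaled denominator
  have key : ‖((x * Q ^ 2 : GaussianInt) : ℂ)‖ ≤ ‖(L : ℂ)‖ * ‖(q : ℂ)‖ ^ (ν - 1) →
      (1 - δ) * c * ‖((x * Q ^ 2 : GaussianInt) : ℂ)‖ ≤ ‖(L : ℂ)‖ * ‖(q : ℂ)‖ ^ (ν - 1) :=
    fun h' => (mul_le_of_le_one_left (norm_nonneg _) hcδ).trans h'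
  by_cases hL0 : L' = 0
  -- Here `p / q = P / Q`; coprimality forces `Q ∣ q`, so `q` is large enough by itself.
  · apply key
    have hLq : L = q := by rw [hLdef, hL0]; ring
    have hdvd : Q ∣ q := by
      have : Q ∣ q * P := ⟨p, by rw [mul_comm Q]; exact sub_eq_zero.1 hL0⟩
      exact hco.symm.dvd_of_dvd_mul_right this
    obtain ⟨s, rfl⟩ := hdvd
    have hs : s ≠ 0 := right_ne_zero_of_mul hq
    rw [hLq, hqν]
    refine hQx.trans (Real.rpow_le_rpow (norm_nonneg _) ?_ (by linarith))
    have ns := one_le_norm_toComplex hs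
    rw [map_mul, norm_mul]
    exact le_mul_of_one_le_right (norm_nonneg _) ns
  · rcases le_or_gt ‖(q : ℂ)‖ (δ * (‖(x : ℂ)‖ * ‖(Q : ℂ)‖)) with hsmall | hlarge
    -- For small `q` the term `x Q L'` dominates `L`, and the hypothesis applies to `p / q` itself.
    · have nL' := one_le_norm_toComplex hL0
      have h1 := h p q hq hL0
      have h2 : (1 - δ) * (‖(x : ℂ)‖ * ‖(Q : ℂ)‖) * ‖(L' : ℂ)‖ ≤ ‖(L : ℂ)‖ := by
        have e : (x : ℂ) * Q * L' = L - q := by rw [hLdef]; simp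
        have h3 : ‖(x : ℂ) * Q * L'‖ ≤ ‖(L : ℂ)‖ + ‖(q : ℂ)‖ := by
          rw [e]; exact norm_sub_le _ _
        rw [norm_mul, norm_mul] at h3
        have h4 : δ * (‖(x : ℂ)‖ * ‖(Q : ℂ)‖) ≤ δ * (‖(x : ℂ)‖ * ‖(Q : ℂ)‖) * ‖(L' : ℂ)‖ :=
          le_mul_of_one_le_right (by positivity) nL'
        linarith
      calc (1 - δ) * c * ‖((x * Q ^ 2 : GaussianInt) : ℂ)‖
          = (1 - δ) * (‖(x : ℂ)‖ * ‖(Q : ℂ)‖) * (c * ‖(Q : ℂ)‖) := by rw [hQ']; ring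
        _ ≤ (1 - δ) * (‖(x : ℂ)‖ * ‖(Q : ℂ)‖) * (‖(L' : ℂ)‖ * ‖(q : ℂ)‖ ^ (ν - 1)) :=
            mul_le_mul_of_nonneg_left h1 (mul_nonneg (by linarith) (by positivity))
        _ = (1 - δ) * (‖(x : ℂ)‖ * ‖(Q : ℂ)‖) * ‖(L' : ℂ)‖ * ‖(q : ℂ)‖ ^ (ν - 1) := by ring
        _ ≤ _ := mul_le_mul_of_nonneg_right h2 hqpos.le
    · rcases le_or_gt (δ * ‖(q : ℂ)‖) ‖(L : ℂ)‖ with hbig | hlt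
      -- `q` and `L` are both large: sizes alone suffice, and `hδQ` absorbs the powers of `δ`.
      · apply key
        set y := ‖(x : ℂ)‖ * ‖(Q : ℂ)‖ with hy
        have hyQ : ‖(Q : ℂ)‖ ≤ y := le_mul_of_one_le_left (norm_nonneg _) nx
        have hy0 : 0 < y := by linarith
        calc ‖((x * Q ^ 2 : GaussianInt) : ℂ)‖ = y * ‖(Q : ℂ)‖ := hQ'
          _ ≤ 1 * y ^ 2 := by nlinarith
          _ ≤ (δ ^ (1 + ν) * y ^ (ν - 2)) * y ^ 2 := by
              refine mul_le_mul_of_nonneg_right (hδQ.trans ?_) (by positivity)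
              exact mul_le_mul_of_nonneg_left
                (Real.rpow_le_rpow (norm_nonneg _) hyQ (by linarith)) (by positivity)
          _ = δ * (δ * y) ^ ν := by
              rw [Real.mul_rpow hδ0.le hy0.le, Real.rpow_add hδ0, Real.rpow_one, mul_assoc,
                ← Real.rpow_natCast y 2, ← Real.rpow_add hy0]
              norm_num
              ring
          _ ≤ δ * ‖(q : ℂ)‖ ^ ν := by
              refine mul_le_mul_of_nonneg_left ?_ hδ0.le
              exact Real.rpow_le_rpow (by positivity) hlarge.le (by linarith)
          _ = δ * ‖(q : ℂ)‖ * ‖(q : ℂ)‖ ^ (ν - 1) := by rw [← hqν]; ring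
          _ ≤ _ := mul_le_mul_of_nonneg_right hbig hqpos.le
      -- Duality: when `L` is small compared with `q`, apply the hypothesis with denominator `L`,
      -- whose linear form is again `L'`. The loss is only `(1 - δ) * (1 + δ) ≤ 1`.
      · have e : L * P - (x * P * L' + p) * Q = L' := by rw [hLdef, hL']; ring
        have h1 := h (x * P * L' + p) L hL (by rw [e]; exact hL0)
        rw [e] at h1
        have h2 : ‖(x : ℂ)‖ * ‖(Q : ℂ)‖ * ‖(L' : ℂ)‖ ≤ (1 + δ) * ‖(q : ℂ)‖ := by
          have e : (x : ℂ) * Q * L' = L - q := by rw [hLdef]; simp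
          rw [← norm_mul, ← norm_mul, e]
          refine (norm_sub_le _ _).trans ?_
          linarith
        have hLq : ‖(L : ℂ)‖ ≤ ‖(q : ℂ)‖ := by nlinarith
        have h3 : ‖(q : ℂ)‖ * ‖(L : ℂ)‖ ^ (ν - 1) ≤ ‖(L : ℂ)‖ * ‖(q : ℂ)‖ ^ (ν - 1) := by
          have s : ∀ z : ℝ, 0 < z → z ^ (ν - 1) = z * z ^ (ν - 2) := fun z hz => by
            rw [← Real.rpow_one_add' hz.le (by linarith)]; congr 1; ring
          rw [s _ (by linarith), s _ (by linarith)]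
          have := Real.rpow_le_rpow (norm_nonneg _) hLq (by linarith : 0 ≤ ν - 2)
          have : ‖(q : ℂ)‖ * ‖(L : ℂ)‖ * ‖(L : ℂ)‖ ^ (ν - 2) ≤
              ‖(q : ℂ)‖ * ‖(L : ℂ)‖ * ‖(q : ℂ)‖ ^ (ν - 2) :=
            mul_le_mul_of_nonneg_left this (by positivity)
          linarith
        have h4 : c * ‖((x * Q ^ 2 : GaussianInt) : ℂ)‖ ≤
            (1 + δ) * (‖(L : ℂ)‖ * ‖(q : ℂ)‖ ^ (ν - 1)) := by
          calc c * ‖((x * Q ^ 2 : GaussianInt) : ℂ)‖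
              = ‖(x : ℂ)‖ * ‖(Q : ℂ)‖ * (c * ‖(Q : ℂ)‖) := by rw [hQ']; ring
            _ ≤ ‖(x : ℂ)‖ * ‖(Q : ℂ)‖ * (‖(L' : ℂ)‖ * ‖(L : ℂ)‖ ^ (ν - 1)) :=
                mul_le_mul_of_nonneg_left h1 (by positivity)
            _ = ‖(x : ℂ)‖ * ‖(Q : ℂ)‖ * ‖(L' : ℂ)‖ * ‖(L : ℂ)‖ ^ (ν - 1) := by ring
            _ ≤ (1 + δ) * ‖(q : ℂ)‖ * ‖(L : ℂ)‖ ^ (ν - 1) :=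
                mul_le_mul_of_nonneg_right h2 (by positivity)
            _ ≤ _ := by rw [mul_assoc]; exact mul_le_mul_of_nonneg_left h3 (by linarith)
        have h5 : 0 ≤ ‖(L : ℂ)‖ * ‖(q : ℂ)‖ ^ (ν - 1) := by positivity
        calc (1 - δ) * c * ‖((x * Q ^ 2 : GaussianInt) : ℂ)‖
            = (1 - δ) * (c * ‖((x * Q ^ 2 : GaussianInt) : ℂ)‖) := by ring
          _ ≤ (1 - δ) * ((1 + δ) * (‖(L : ℂ)‖ * ‖(q : ℂ)‖ ^ (ν - 1))) :=
              mul_le_mul_of_nonneg_left h4 (by linarith)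
          _ ≤ _ := by nlinarith [mul_nonneg (sq_nonneg δ) h5]

open Filter Topology in
/-- A limit of iterated folds `P (j + 1) / Q (j + 1) = P j / Q j + 1 / (x j * Q j ^ 2)` is badly
approximable of every order `ν > 2` such that eventually `|Q (j + 1)| ≤ |Q j| ^ ν`. -/
theorem exists_lower_bound_of_tendsto_fold {ν : ℝ} (hν : 2 < ν) {P Q x : ℕ → GaussianInt}
    (hP : ∀ j, P (j + 1) = x j * Q j * P j + 1) (hQ : ∀ j, Q (j + 1) = x j * Q j ^ 2)
    (hx : ∀ j, x j ≠ 0) (hQ0 : Q 0 ≠ 0) (hco0 : IsCoprime (P 0) (Q 0))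
    (hgrow : ∀ᶠ j : ℕ in atTop, 1 ≤ (1 / ((j : ℝ) + 2) ^ 2) ^ (1 + ν) * ‖(Q j : ℂ)‖ ^ (ν - 2))
    (hexp : ∀ᶠ j : ℕ in atTop, ‖(Q (j + 1) : ℂ)‖ ≤ ‖(Q j : ℂ)‖ ^ ν) {ξ : ℂ}
    (hξ : Tendsto (fun j => (P j : ℂ) / (Q j : ℂ)) atTop (𝓝 ξ)) :
    ∃ c : ℝ, 0 < c ∧ ∀ p q : GaussianInt, q ≠ 0 →
      c ≤ ‖(q : ℂ) * ξ - p‖ * ‖(q : ℂ)‖ ^ (ν - 1) := by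
  have hQne : ∀ j, Q j ≠ 0 := by
    intro j
    induction j with
    | zero => exact hQ0
    | succ j ih => rw [hQ]; exact mul_ne_zero (hx j) (pow_ne_zero _ ih)
  have hco : ∀ j, IsCoprime (P j) (Q j) := by
    intro j
    cases j with
    | zero => exact hco0
    | succ j =>
      have h : IsCoprime (P (j + 1)) (x j * Q j) := ⟨1, -P j, by rw [hP]; ring⟩
      rw [hQ, pow_two, ← mul_assoc]
      exact h.mul_right h.of_mul_right_right
  obtain ⟨m, hm⟩ := eventually_atTop.1 (hgrow.and hexp)
  have nQm := one_le_norm_toComplex (hQne m)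
  set c : ℝ := 1 / (2 * ‖(Q m : ℂ)‖) with hc
  have hc0 : 0 < c := by positivity
  have hc1 : c ≤ 1 / 2 := by
    rw [hc]; exact one_div_le_one_div_of_le (by norm_num) (by linarith)
  have hbound : ∀ j : ℕ, 1 / ((j : ℝ) + 1) ≤ 1 := fun j => by
    rw [div_le_one (by positivity)]; linarith [(Nat.cast_nonneg j : (0 : ℝ) ≤ j)]
  -- With `δ = 1 / (j + 2) ^ 2` the losses telescope: `(1 - δ) * (1 + 1 / (j + 1)) = 1 + 1 / (j +
  -- 2)`. The constant thus never falls below `c`.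
  have main : ∀ j ≥ m, BadlyApproximable ν (c * (1 + 1 / ((j : ℝ) + 1))) (P j) (Q j) := by
    intro j hj
    induction j, hj using Nat.le_induction with
    | base =>
      refine badlyApproximable_of_mul_norm_le_one (by linarith) ?_
      have : c * ‖(Q m : ℂ)‖ = 1 / 2 := by rw [hc]; field_simp
      nlinarith [hbound m]
    | succ j hj ih =>
      have hpos : (0 : ℝ) < 1 / ((j : ℝ) + 1) := by positivity
      have hδ1 : 1 / ((j : ℝ) + 2) ^ 2 < 1 := by
        rw [div_lt_one (by positivity)]; nlinarith [(Nat.cast_nonneg j : (0 : ℝ) ≤ j)]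
      have := ih.fold hν (by positivity) (by nlinarith [hbound j]) (by positivity) hδ1 (hQne j)
        (hx j) (hco j) (hm j hj).1 (by rw [← hQ]; exact (hm j hj).2)
      rw [hP, hQ]
      convert this using 1
      push_cast
      field_simp
      ring
  refine ⟨c, hc0, fun p q hq => ?_⟩
  have hlim : Tendsto (fun j => ‖(q : ℂ) * ((P j : ℂ) / (Q j : ℂ)) - p‖ * ‖(q : ℂ)‖ ^ (ν - 1)) atTop
      (𝓝 (‖(q : ℂ) * ξ - p‖ * ‖(q : ℂ)‖ ^ (ν - 1))) :=
    (((hξ.const_mul _).sub_const _).norm).mul_const _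
  refine ge_of_tendsto_of_frequently hlim (frequently_atTop.2 fun a => ?_)
  -- If `p / q` equals one convergent, its linear form at the next one is `q ≠ 0`.
  have hj : ∃ j ≥ max a m, q * P j - p * Q j ≠ 0 := by
    by_cases h : q * P (max a m) - p * Q (max a m) = 0
    · refine ⟨max a m + 1, Nat.le_succ _, ?_⟩
      have : q * P (max a m + 1) - p * Q (max a m + 1) =
          x (max a m) * Q (max a m) * (q * P (max a m) - p * Q (max a m)) + q := by
        rw [hP, hQ]; ring
      rw [this, h]
      simpa using hq
    · exact ⟨_, le_rfl, h⟩
  obtain ⟨j, hj, hne⟩ := hj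
  refine ⟨j, (le_max_left _ _).trans hj, ?_⟩
  have h1 := main j ((le_max_right _ _).trans hj) p q hq hne
  have nQ := one_le_norm_toComplex (hQne j)
  have hQc : (Q j : ℂ) ≠ 0 := by rw [← norm_pos_iff]; linarith
  have e : (q : ℂ) * ((P j : ℂ) / (Q j : ℂ)) - p =
      ((q * P j - p * Q j : GaussianInt) : ℂ) / (Q j : ℂ) := by
    simp only [map_sub, map_mul]; field_simp
  rw [e, norm_div, div_mul_eq_mul_div, le_div_iff₀ (by linarith)]
  refine le_trans (mul_le_mul_of_nonneg_right ?_ (norm_nonneg _)) h1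
  exact le_mul_of_one_le_right hc0.le (le_add_of_nonneg_right (by positivity))

/-! ### From lower bounds to the irrationality exponent -/

theorem finite_norm_toComplex_le (R : ℝ) : {q : GaussianInt | ‖(q : ℂ)‖ ≤ R}.Finite := by
  have hf : (Set.Icc (-⌈R⌉) ⌈R⌉ ×ˢ Set.Icc (-⌈R⌉) ⌈R⌉ : Set (ℤ × ℤ)).Finite :=
    (Set.finite_Icc _ _).prod (Set.finite_Icc _ _)
  refine (hf.image fun z : ℤ × ℤ => (⟨z.1, z.2⟩ : GaussianInt)).subset fun q hq => ?_
  have bound : ∀ a : ℤ, |(a : ℝ)| ≤ ‖(q : ℂ)‖ → a ∈ Set.Icc (-⌈R⌉) ⌈R⌉ := fun a ha => by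
    have h : |(a : ℝ)| ≤ (⌈R⌉ : ℝ) := (ha.trans hq).trans (Int.le_ceil R)
    have h' : |a| ≤ ⌈R⌉ := by exact_mod_cast h
    exact abs_le.1 h'
  refine ⟨(q.re, q.im), ⟨bound _ ?_, bound _ ?_⟩, rfl⟩
  · simpa using Complex.abs_re_le_norm (q : ℂ)
  · simpa using Complex.abs_im_le_norm (q : ℂ)

theorem notMem_gaussianRationals_of_lower_bound {ν c : ℝ} (hc : 0 < c) {ξ : ℂ}
    (h : ∀ p q : GaussianInt, q ≠ 0 → c ≤ ‖(q : ℂ) * ξ - p‖ * ‖(q : ℂ)‖ ^ (ν - 1)) :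
    ξ ∉ gaussianRationals := by
  rintro ⟨p, q, hq, rfl⟩
  have hqc : (q : ℂ) ≠ 0 := by simpa using hq
  have := h p q hq
  rw [mul_div_cancel₀ _ hqc] at this
  simp at this
  linarith

/-- The two inequalities give `|q| ^ (ν' - ν) < 1 / c`; then `p` is bounded because `p / q` is
within `1` of `ξ`. -/
theorem gaussianApproximants_finite_of_lower_bound {ν ν' c : ℝ} (hν : 0 < ν) (hν' : ν < ν')
    (hc : 0 < c) {ξ : ℂ}
    (h : ∀ p q : GaussianInt, q ≠ 0 → c ≤ ‖(q : ℂ) * ξ - p‖ * ‖(q : ℂ)‖ ^ (ν - 1)) :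
    (gaussianApproximants ξ ν').Finite := by
  set R : ℝ := (1 / c) ^ (1 / (ν' - ν)) with hR
  have hf := (finite_norm_toComplex_le (R * (‖ξ‖ + 1))).prod (finite_norm_toComplex_le R)
  refine (hf.image fun z : GaussianInt × GaussianInt => (z.1 : ℂ) / (z.2 : ℂ)).subset ?_
  rintro r ⟨p, q, hq, rfl, hlt⟩
  have nq := one_le_norm_toComplex hq
  have hq0 : 0 < ‖(q : ℂ)‖ := by linarith
  have hqc : (q : ℂ) ≠ 0 := by simpa using hq
  have hp0 : 0 < ‖(q : ℂ)‖ ^ ν' := Real.rpow_pos_of_pos hq0 _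
  have e : (q : ℂ) * ξ - p = q * (ξ - p / q) := by field_simp
  have h1 := h p q hq
  rw [e, norm_mul] at h1
  have h2 : c < ‖(q : ℂ)‖ ^ (ν - ν') := by
    calc c ≤ ‖(q : ℂ)‖ * ‖ξ - p / q‖ * ‖(q : ℂ)‖ ^ (ν - 1) := h1
      _ = ‖ξ - p / q‖ * ‖(q : ℂ)‖ ^ ν := by
          have : ‖(q : ℂ)‖ ^ ν = ‖(q : ℂ)‖ * ‖(q : ℂ)‖ ^ (ν - 1) := by
            rw [← Real.rpow_one_add' hq0.le (by linarith)]; congr 1; ring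
          rw [this]; ring
      _ < 1 / ‖(q : ℂ)‖ ^ ν' * ‖(q : ℂ)‖ ^ ν :=
          mul_lt_mul_of_pos_right hlt (Real.rpow_pos_of_pos hq0 _)
      _ = _ := by rw [Real.rpow_sub hq0]; ring
  have h3 : ‖(q : ℂ)‖ ≤ R := by
    have h4 : ‖(q : ℂ)‖ ^ (ν' - ν) ≤ 1 / c := by
      rw [le_div_iff₀ hc, ← le_div_iff₀' (Real.rpow_pos_of_pos hq0 _), one_div,
        ← Real.rpow_neg hq0.le, neg_sub]
      exact h2.le
    rw [hR, ← Real.rpow_rpow_inv hq0.le (by linarith : ν' - ν ≠ 0), one_div (ν' - ν)]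
    exact Real.rpow_le_rpow (by positivity) h4 (by simpa using by linarith)
  refine ⟨(p, q), ⟨?_, h3⟩, rfl⟩
  have h5 : ‖ξ - p / q‖ ≤ 1 := by
    refine hlt.le.trans ?_
    rw [div_le_one hp0]
    exact Real.one_le_rpow nq (by linarith)
  have h6 : ‖(p : ℂ)‖ = ‖(q : ℂ)‖ * ‖(p : ℂ) / q‖ := by
    rw [← norm_mul, mul_div_cancel₀ _ hqc]
  have h7 : ‖(p : ℂ) / q‖ ≤ ‖ξ‖ + 1 := by
    have : (p : ℂ) / q = ξ - (ξ - p / q) := by ring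
    rw [this]
    exact (norm_sub_le _ _).trans (by linarith)
  change ‖(p : ℂ)‖ ≤ R * (‖ξ‖ + 1)
  rw [h6]
  exact mul_le_mul h3 h7 (norm_nonneg _) (by linarith)

theorem gaussianIrrationalityExponent_eq {ξ : ℂ} {τ : ℝ}
    (hlow : ∀ ν < τ, (gaussianApproximants ξ ν).Infinite)
    (hup : ∀ ν > τ, (gaussianApproximants ξ ν).Finite) :
    gaussianIrrationalityExponent ξ = (τ : EReal) := by
  apply le_antisymm
  · refine sSup_le ?_
    rintro _ ⟨ν, hν, rfl⟩
    by_contra! hlt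
    exact hν (hup ν (EReal.coe_lt_coe_iff.1 hlt))
  · refine le_of_forall_lt fun a ha => ?_
    obtain ⟨z, haz, hz⟩ := EReal.lt_iff_exists_real_btwn.1 ha
    exact haz.trans_le (le_sSup ⟨z, hlow z (EReal.coe_lt_coe_iff.1 hz), rfl⟩)

/-! ### Lacunary series; `4 / 3` is a rational lower bound for `√2 ≤ |b|` -/

section LacunarySeries

variable {b : ℂ} {n : ℕ → ℕ}

theorem summable_lacunary (hb : 4 / 3 ≤ ‖b‖) (hn : StrictMono n) :
    Summable fun k => (b ^ n k)⁻¹ := by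
  have h1 : ‖b⁻¹‖ < 1 := by
    rw [norm_inv]; exact inv_lt_one_of_one_lt₀ (by linarith)
  simpa [Function.comp_def] using
    (summable_geometric_of_norm_lt_one h1).comp_injective hn.injective

theorem tsum_mem_digitSeriesSet (hb : 4 / 3 ≤ ‖b‖) (hn : StrictMono n) (hn0 : 0 < n 0) :
    ∑' k, (b ^ n k)⁻¹ ∈ digitSeriesSet b {0, 1} := by
  classical
  have hpos : ∀ k, 0 < n k := fun k => hn0.trans_le (hn.monotone k.zero_le)
  refine ⟨fun j => if j + 1 ∈ Set.range n then 1 else 0, fun j => ?_, ?_⟩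
  · by_cases h : j + 1 ∈ Set.range n <;> simp [h]
  · have hinj : Function.Injective fun k => n k - 1 := fun k l h => by
      have := hpos k
      have := hpos l
      exact hn.injective (by simp only at h; omega)
    rw [← hinj.hasSum_iff]
    · convert (summable_lacunary hb hn).hasSum using 2 with k
      have : n k - 1 + 1 = n k := Nat.sub_add_cancel (hpos k)
      simp [this]
    · intro j hj
      have : j + 1 ∉ Set.range n := by
        rintro ⟨k, hk⟩
        exact hj ⟨k, by simp [hk]⟩
      simp only [this, if_false, Nat.cast_zero, zero_mul]

theorem norm_tsum_sub_sum_le (hb : 4 / 3 ≤ ‖b‖) (hn : StrictMono n) (j : ℕ) :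
    ‖∑' k, (b ^ n k)⁻¹ - ∑ k ∈ Finset.range j, (b ^ n k)⁻¹‖ ≤ 4 * (‖b‖ ^ n j)⁻¹ := by
  have hb0 : 0 < ‖b‖ := by linarith
  have hρ : ‖b‖⁻¹ ≤ 3 / 4 := by
    rw [inv_le_comm₀ hb0 (by norm_num)]; linarith
  have hs := summable_lacunary hb hn
  rw [← hs.sum_add_tsum_nat_add j, add_sub_cancel_left]
  have hle : ∀ k, ‖(b ^ n (k + j))⁻¹‖ ≤ (‖b‖ ^ n j)⁻¹ * (3 / 4) ^ k := fun k => by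
    have h1 : n j + k ≤ n (k + j) := by
      have := hn.add_le_nat k j
      linarith
    rw [norm_inv, norm_pow, ← inv_pow, ← inv_pow]
    calc ‖b‖⁻¹ ^ n (k + j) ≤ ‖b‖⁻¹ ^ (n j + k) :=
          pow_le_pow_of_le_one (by positivity) (by linarith) h1
      _ = ‖b‖⁻¹ ^ n j * ‖b‖⁻¹ ^ k := pow_add _ _ _
      _ ≤ _ := by gcongr
  have hg : HasSum (fun k : ℕ => (‖b‖ ^ n j)⁻¹ * (3 / 4 : ℝ) ^ k) ((‖b‖ ^ n j)⁻¹ * 4) := by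
    have := hasSum_geometric_of_lt_one (r := (3 / 4 : ℝ)) (by norm_num) (by norm_num)
    norm_num at this
    exact this.mul_left _
  rw [mul_comm]
  exact tsum_of_norm_bounded hg hle

end LacunarySeries

/-! ### Perturbed exponents and their truncations -/

/-- Exponents growing by the factor `τ`, perturbed by a binary sequence `e`. -/
noncomputable def perturbedExponent (τ : ℝ) (e : ℕ → Bool) : ℕ → ℕ
  | 0 => 16
  | j + 1 => ⌈τ * perturbedExponent τ e j⌉₊ + (e j).toNat

section PerturbedExponent

variable {τ : ℝ} {e : ℕ → Bool}

theorem mul_le_perturbedExponent_succ (j : ℕ) :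
    τ * perturbedExponent τ e j ≤ perturbedExponent τ e (j + 1) := by
  rw [perturbedExponent]
  push_cast
  have := Nat.le_ceil (τ * perturbedExponent τ e j)
  have : (0 : ℝ) ≤ ((e j).toNat : ℝ) := Nat.cast_nonneg _
  linarith

theorem perturbedExponent_succ_le (hτ : 2 ≤ τ) (j : ℕ) :
    (perturbedExponent τ e (j + 1) : ℝ) ≤ τ * perturbedExponent τ e j + 2 := by
  rw [perturbedExponent]
  push_cast
  have := Nat.ceil_lt_add_one (by positivity : 0 ≤ τ * (perturbedExponent τ e j : ℝ))
  have : ((e j).toNat : ℝ) ≤ 1 := by exact_mod_cast Bool.toNat_le _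
  linarith

theorem two_mul_perturbedExponent_le (hτ : 2 ≤ τ) (j : ℕ) :
    2 * perturbedExponent τ e j ≤ perturbedExponent τ e (j + 1) := by
  have h : (2 : ℝ) * perturbedExponent τ e j ≤ perturbedExponent τ e (j + 1) :=
    (mul_le_mul_of_nonneg_right hτ (Nat.cast_nonneg _)).trans (mul_le_perturbedExponent_succ j)
  exact_mod_cast h

theorem add_le_perturbedExponent (hτ : 2 ≤ τ) (j : ℕ) : j + 16 ≤ perturbedExponent τ e j := by
  induction j with
  | zero => simp [perturbedExponent]
  | succ j ih => have := two_mul_perturbedExponent_le (e := e) hτ j; omega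

theorem strictMono_perturbedExponent (hτ : 2 ≤ τ) : StrictMono (perturbedExponent τ e) :=
  strictMono_nat_of_lt_succ fun j => by
    have := two_mul_perturbedExponent_le (e := e) hτ j
    have := add_le_perturbedExponent (e := e) hτ j
    omega

theorem perturbedExponent_congr {e' : ℕ → Bool} {j : ℕ} (h : ∀ k < j, e k = e' k) :
    ∀ k ≤ j, perturbedExponent τ e k = perturbedExponent τ e' k := by
  intro k
  induction k with
  | zero => intro _; rfl
  | succ k ih => intro hk; rw [perturbedExponent, perturbedExponent, ih (by omega), h k (by omega)]

end PerturbedExponent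

/-- The series `∑ b ^ (-n j)` over the perturbed exponents `n j`. -/
noncomputable def perturbedSeries (b : ℂ) (τ : ℝ) (e : ℕ → Bool) : ℂ :=
  ∑' k, (b ^ perturbedExponent τ e k)⁻¹

/-- The numerators of the partial sums of `∑ B ^ (-n j)` over the denominators `B ^ n j`. -/
def lacunaryNumerator (B : GaussianInt) (n : ℕ → ℕ) : ℕ → GaussianInt
  | 0 => 1
  | j + 1 => B ^ (n (j + 1) - n j) * lacunaryNumerator B n j + 1

theorem lacunaryNumerator_div {B : GaussianInt} (hB : B ≠ 0) {n : ℕ → ℕ} (hn : Monotone n) (j : ℕ) :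
    (lacunaryNumerator B n j : ℂ) / ((B ^ n j : GaussianInt) : ℂ) =
      ∑ k ∈ Finset.range (j + 1), ((B : ℂ) ^ n k)⁻¹ := by
  have hBc : (B : ℂ) ≠ 0 := by simpa using hB
  induction j with
  | zero => simp [lacunaryNumerator]
  | succ j ih =>
    have h : (B : ℂ) ^ n (j + 1) = (B : ℂ) ^ (n (j + 1) - n j) * (B : ℂ) ^ n j := by
      rw [← pow_add, Nat.sub_add_cancel (hn j.le_succ)]
    rw [Finset.sum_range_succ, ← ih, lacunaryNumerator]
    simp only [map_add, map_mul, map_pow, map_one]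
    rw [h]
    field_simp

open Filter Topology in
theorem tendsto_lacunaryNumerator_div {B : GaussianInt} (hb : 4 / 3 ≤ ‖(B : ℂ)‖) {n : ℕ → ℕ}
    (hn : StrictMono n) :
    Tendsto (fun j => (lacunaryNumerator B n j : ℂ) / ((B ^ n j : GaussianInt) : ℂ)) atTop
      (𝓝 (∑' k, ((B : ℂ) ^ n k)⁻¹)) := by
  have hB : B ≠ 0 := by rintro rfl; norm_num at hb
  simp_rw [lacunaryNumerator_div hB hn.monotone]
  exact (summable_lacunary hb hn).hasSum.tendsto_sum_nat.comp (tendsto_add_atTop_nat 1)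

/-! ### Exponent of the perturbed series -/

open Filter Topology in
theorem exists_lower_bound_perturbedSeries {B : GaussianInt} {τ ν : ℝ} {e : ℕ → Bool}
    (hb : 4 / 3 ≤ ‖(B : ℂ)‖) (hτ : 2 ≤ τ) (hν : τ < ν) :
    ∃ c : ℝ, 0 < c ∧ ∀ p q : GaussianInt, q ≠ 0 →
      c ≤ ‖(q : ℂ) * perturbedSeries B τ e - p‖ * ‖(q : ℂ)‖ ^ (ν - 1) := by
  have hB : B ≠ 0 := by rintro rfl; norm_num at hb
  have hb0 : 0 < ‖(B : ℂ)‖ := by linarith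
  have h2 : 2 < ν := by linarith
  set n := perturbedExponent τ e with hn
  have hmono : StrictMono n := strictMono_perturbedExponent hτ
  have hdbl : ∀ j, 2 * n j ≤ n (j + 1) := two_mul_perturbedExponent_le hτ
  have hadd : ∀ j, j + 16 ≤ n j := add_le_perturbedExponent hτ
  have hrpow : ∀ (m : ℕ) (s : ℝ), ‖((B ^ m : GaussianInt) : ℂ)‖ ^ s = ‖(B : ℂ)‖ ^ (m * s) := by
    intro m s
    rw [map_pow, norm_pow, ← Real.rpow_natCast_mul hb0.le]
  refine exists_lower_bound_of_tendsto_fold (P := lacunaryNumerator B n) (Q := fun j => B ^ n j)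
    (x := fun j => B ^ (n (j + 1) - 2 * n j)) h2 (fun j => ?_) (fun j => ?_)
    (fun j => pow_ne_zero _ hB) (pow_ne_zero _ hB) isCoprime_one_left ?_ ?_
    (tendsto_lacunaryNumerator_div hb hmono)
  · rw [lacunaryNumerator, ← pow_add]
    congr 3
    have := hdbl j
    omega
  · rw [← pow_mul, ← pow_add]
    congr 1
    have := hdbl j
    omega
  -- Growth: `|B ^ n j| ^ (ν - 2)` is at least exponential in `j`, while `(j + 2) ^ (2 * (1 + ν))`
  -- is polynomial.
  · set K : ℝ := (4 / 3) ^ (ν - 2) with hK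
    have hK1 : 1 < K := Real.one_lt_rpow (by norm_num) (by linarith)
    have hlim := (tendsto_pow_const_div_const_pow_of_one_lt (2 * ⌈1 + ν⌉₊) hK1).comp
      (tendsto_add_atTop_nat 2)
    filter_upwards [hlim.eventually_lt_const one_pos] with j hj
    simp only [Function.comp_apply, Nat.cast_add, Nat.cast_ofNat] at hj
    rw [div_lt_one (by positivity)] at hj
    have hj1 : (1 : ℝ) ≤ ((j : ℝ) + 2) ^ 2 := by nlinarith [(Nat.cast_nonneg j : (0 : ℝ) ≤ j)]
    have h3 : (((j : ℝ) + 2) ^ 2) ^ (1 + ν) ≤ K ^ (j + 2) := by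
      refine le_trans ?_ hj.le
      rw [pow_mul, ← Real.rpow_natCast _ ⌈1 + ν⌉₊]
      exact Real.rpow_le_rpow_of_exponent_le hj1 (Nat.le_ceil _)
    have h4 : K ^ (j + 2) ≤ ‖((B ^ n j : GaussianInt) : ℂ)‖ ^ (ν - 2) := by
      rw [hK, ← Real.rpow_mul_natCast (by norm_num), mul_comm, Real.rpow_natCast_mul (by norm_num)]
      refine Real.rpow_le_rpow (by positivity) ?_ (by linarith)
      rw [map_pow, norm_pow]
      exact (pow_le_pow_left₀ (by norm_num) hb _).trans
        (pow_le_pow_right₀ (by linarith) (by have := hadd j; omega))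
    rw [Real.div_rpow zero_le_one (by positivity), Real.one_rpow, div_mul_eq_mul_div, one_mul,
      one_le_div (by positivity)]
    exact h3.trans h4
  · filter_upwards [eventually_ge_atTop ⌈2 / (ν - τ)⌉₊] with j hj
    rw [hrpow, map_pow, norm_pow, ← Real.rpow_natCast]
    refine Real.rpow_le_rpow_of_exponent_le (by linarith) ?_
    have h3 : (n (j + 1) : ℝ) ≤ τ * n j + 2 := perturbedExponent_succ_le hτ j
    have h4 : 2 / (ν - τ) ≤ n j := by
      refine (Nat.le_ceil _).trans ?_
      exact_mod_cast hj.trans (by have := hadd j; omega)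
    rw [div_le_iff₀ (by linarith)] at h4
    linarith

open Filter Topology in
-- A finite set is closed, so it would contain the limit of the truncations, making the sum a
-- Gaussian rational.
theorem infinite_gaussianApproximants_perturbedSeries {B : GaussianInt} {τ ν : ℝ} {e : ℕ → Bool}
    (hb : 4 / 3 ≤ ‖(B : ℂ)‖) (hτ : 2 ≤ τ) (hν : ν < τ) :
    (gaussianApproximants (perturbedSeries B τ e) ν).Infinite := by
  intro hfin
  have hB : B ≠ 0 := by rintro rfl; norm_num at hb
  have hb0 : 0 < ‖(B : ℂ)‖ := by linarith
  obtain ⟨c, hc, hlow⟩ := exists_lower_bound_perturbedSeries (e := e) hb hτ (lt_add_one τ)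
  have hmono : StrictMono (perturbedExponent τ e) := strictMono_perturbedExponent hτ
  have hmem : perturbedSeries B τ e ∈ gaussianApproximants (perturbedSeries B τ e) ν := by
    refine hfin.isClosed.mem_of_tendsto (tendsto_lacunaryNumerator_div hb hmono) ?_
    -- The tail constant `4` is below `|B| ^ 6`, and here `ν * n j + 6 ≤ τ * n j`.
    filter_upwards [eventually_ge_atTop ⌈6 / (τ - ν)⌉₊] with j hj
    refine ⟨_, _, pow_ne_zero _ hB, rfl, ?_⟩
    rw [lacunaryNumerator_div hB hmono.monotone]
    refine (norm_tsum_sub_sum_le hb hmono (j + 1)).trans_lt ?_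
    rw [map_pow, norm_pow, ← Real.rpow_natCast_mul hb0.le, ← Real.rpow_natCast,
      ← div_eq_mul_inv, div_lt_div_iff₀ (by positivity) (by positivity), one_mul]
    have h4 : (4 : ℝ) < ‖(B : ℂ)‖ ^ (6 : ℝ) := by
      have := pow_le_pow_left₀ (by norm_num) hb 6
      norm_num at this ⊢
      linarith
    refine (mul_lt_mul_of_pos_right h4 (by positivity)).trans_le ?_
    rw [← Real.rpow_add hb0]
    refine Real.rpow_le_rpow_of_exponent_le (by linarith) ?_
    have h5 : 6 / (τ - ν) ≤ perturbedExponent τ e j := by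
      refine (Nat.le_ceil _).trans ?_
      exact_mod_cast hj.trans (by have := add_le_perturbedExponent (e := e) hτ j; omega)
    rw [div_le_iff₀ (by linarith)] at h5
    have := mul_le_perturbedExponent_succ (τ := τ) (e := e) j
    linarith
  obtain ⟨p, q, hq, h, -⟩ := hmem
  exact notMem_gaussianRationals_of_lower_bound hc hlow ⟨p, q, hq, h⟩

/-- After the first differing bit the exponents are `N` and `N + 1`. Those terms differ by at least
`|b| ^ (-N) / 4`, while the two tails start beyond `2 * N`. -/
theorem injective_perturbedSeries {b : ℂ} {τ : ℝ} (hb : 4 / 3 ≤ ‖b‖) (hτ : 2 ≤ τ) :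
    Function.Injective (perturbedSeries b τ) := by
  have hb0 : 0 < ‖b‖ := by linarith
  -- sequences first differing at `j` have distinct sums
  have key : ∀ e e' : ℕ → Bool, ∀ j, (∀ k < j, e k = e' k) → e j = false → e' j = true →
      perturbedSeries b τ e ≠ perturbedSeries b τ e' := by
    intro e e' j hlt he he' heq
    have hcongr := perturbedExponent_congr (τ := τ) hlt
    set N := perturbedExponent τ e (j + 1) with hN
    have hN' : perturbedExponent τ e' (j + 1) = N + 1 := by
      rw [hN, perturbedExponent, perturbedExponent, hcongr j le_rfl, he, he']; rfl
    have hN16 : 16 ≤ N := by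
      have := add_le_perturbedExponent (e := e) hτ (j + 1)
      omega
    have tail : ∀ f : ℕ → Bool, N ≤ perturbedExponent τ f (j + 1) →
        ‖perturbedSeries b τ f - ∑ k ∈ Finset.range (j + 2), (b ^ perturbedExponent τ f k)⁻¹‖ ≤
          4 * (‖b‖ ^ (2 * N))⁻¹ := by
      intro f hf
      refine (norm_tsum_sub_sum_le hb (strictMono_perturbedExponent hτ) (j + 2)).trans ?_
      have h1 := two_mul_perturbedExponent_le (e := f) hτ (j + 1)
      gcongr 4 * (?_)⁻¹
      exact pow_le_pow_right₀ (by linarith) (le_trans (by omega) h1)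
    have t1 := tail e le_rfl
    have t2 := tail e' (by omega)
    rw [Finset.sum_range_succ, ← hN] at t1
    set S := ∑ k ∈ Finset.range (j + 1), (b ^ perturbedExponent τ e k)⁻¹
    have hS : ∑ k ∈ Finset.range (j + 1), (b ^ perturbedExponent τ e' k)⁻¹ = S :=
      Finset.sum_congr rfl fun k hk => by
        rw [hcongr k (Nat.lt_succ_iff.1 (Finset.mem_range.1 hk))]
    rw [Finset.sum_range_succ, hN', ← heq, hS] at t2
    have h1 : ‖(b ^ N)⁻¹ - (b ^ (N + 1))⁻¹‖ ≤ 8 * (‖b‖ ^ (2 * N))⁻¹ := by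
      have e1 : (b ^ N)⁻¹ - (b ^ (N + 1))⁻¹ =
          (perturbedSeries b τ e - (S + (b ^ (N + 1))⁻¹)) -
            (perturbedSeries b τ e - (S + (b ^ N)⁻¹)) := by ring
      rw [e1]
      exact (norm_sub_le _ _).trans (by linarith)
    have hρ : ‖b‖⁻¹ ≤ 3 / 4 := by
      rw [inv_le_comm₀ hb0 (by norm_num)]; linarith
    have h2 : (‖b‖ ^ N)⁻¹ * (1 / 4) ≤ ‖(b ^ N)⁻¹ - (b ^ (N + 1))⁻¹‖ := by
      have e2 : (b ^ N)⁻¹ - (b ^ (N + 1))⁻¹ = (b ^ N)⁻¹ * (1 - b⁻¹) := by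
        rw [pow_succ, mul_inv]; ring
      rw [e2, norm_mul, norm_inv, norm_pow]
      refine mul_le_mul_of_nonneg_left ?_ (by positivity)
      have := norm_sub_norm_le (1 : ℂ) b⁻¹
      rw [norm_one, norm_inv] at this
      linarith
    -- This is why the exponents start at `16`: `8 * (3 / 4) ^ 16 < 1 / 4`.
    have h3 : (‖b‖ ^ N)⁻¹ ≤ (3 / 4) ^ 16 := by
      rw [← inv_pow]
      calc ‖b‖⁻¹ ^ N ≤ ‖b‖⁻¹ ^ 16 := pow_le_pow_of_le_one (by positivity) (by linarith) hN16
        _ ≤ _ := pow_le_pow_left₀ (by positivity) hρ _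
    have h4 : (‖b‖ ^ (2 * N))⁻¹ = (‖b‖ ^ N)⁻¹ * (‖b‖ ^ N)⁻¹ := by
      rw [two_mul, pow_add, mul_inv]
    have h5 : 0 < (‖b‖ ^ N)⁻¹ := by positivity
    rw [h4] at h1
    norm_num at h3
    nlinarith
  intro e e' heq
  by_contra hne
  obtain ⟨i, hi⟩ := Function.ne_iff.1 hne
  have hex : ∃ i, e i ≠ e' i := ⟨i, hi⟩
  have hmin : ∀ k < Nat.find hex, e k = e' k := fun k hk => not_not.1 (Nat.find_min hex hk)
  have hdiff := Nat.find_spec hex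
  rcases h : e (Nat.find hex) with _ | _
  · exact key e e' _ hmin h (by rw [h] at hdiff; simpa using hdiff.symm) heq
  · exact key e' e _ (fun k hk => (hmin k hk).symm) (by rw [h] at hdiff; simpa using hdiff.symm) h
      heq.symm

theorem mainTheorem3 (τ : ℝ) (hτ : 2 ≤ τ) (A : ℕ) (hA : 1 ≤ A) (b : ℂ)
    (hb : b = -(A : ℂ) + Complex.I ∨ b = -(A : ℂ) - Complex.I) :
    ¬ {ξ : ℂ | ξ ∈ digitSeriesSet b {0, 1} ∧ ξ ∉ gaussianRationals ∧
        gaussianIrrationalityExponent ξ = (τ : EReal)}.Countable := by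
  obtain ⟨B, hB, hnorm⟩ : ∃ B : GaussianInt, (B : ℂ) = b ∧ 4 / 3 ≤ ‖b‖ := by
    have hA' : (1 : ℝ) ≤ A := by exact_mod_cast hA
    have hn : ‖b‖ ^ 2 = (A : ℝ) ^ 2 + 1 := by
      rw [← Complex.normSq_eq_norm_sq, Complex.normSq_apply]
      rcases hb with rfl | rfl <;> simp <;> ring
    refine ⟨⟨-A, if b = -(A : ℂ) + Complex.I then 1 else -1⟩, ?_, ?_⟩
    · split_ifs with h
      · rw [h, GaussianInt.toComplex_def']; simp
      · rw [hb.resolve_left h, GaussianInt.toComplex_def']; simp; ring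
    · nlinarith [norm_nonneg b]
  subst hB
  intro hcount
  have hsub : Set.range (perturbedSeries B τ) ⊆ {ξ : ℂ | ξ ∈ digitSeriesSet B {0, 1} ∧
      ξ ∉ gaussianRationals ∧ gaussianIrrationalityExponent ξ = (τ : EReal)} := by
    rintro _ ⟨e, rfl⟩
    refine ⟨tsum_mem_digitSeriesSet hnorm (strictMono_perturbedExponent hτ)
      (by simp [perturbedExponent]), ?_, gaussianIrrationalityExponent_eq
      (fun ν hν => infinite_gaussianApproximants_perturbedSeries hnorm hτ hν) fun ν hν => ?_⟩
    · obtain ⟨c, hc, h⟩ := exists_lower_bound_perturbedSeries (e := e) hnorm hτ (lt_add_one τ)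
      exact notMem_gaussianRationals_of_lower_bound hc h
    -- Finiteness at order `ν` needs a lower bound of strictly smaller order, still above `τ`.
    · obtain ⟨ν', h1, h2⟩ := exists_between hν
      obtain ⟨c, hc, h⟩ := exists_lower_bound_perturbedSeries (e := e) hnorm hτ h1
      exact gaussianApproximants_finite_of_lower_bound (by linarith) h2 hc h
  have h1 : Countable (ℕ → Bool) := by
    have := (hcount.mono hsub).to_subtype
    exact (Set.rangeFactorization_injective.2 (injective_perturbedSeries hnorm hτ)).countable
  have h2 := Cardinal.mk_le_aleph0_iff.2 h1
  simp only [Cardinal.mk_pi, Cardinal.mk_bool, Cardinal.prod_const', Cardinal.mk_nat] at h2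
  exact (Cardinal.cantor _).not_ge h2
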